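/- Let $\psi(x)=\frac{d}{dx}\log\Gamma(x)$ be the digamma function and $\psi_1(x)=\frac{d^2}{dx^2}\log\Gamma(x)$ the trigamma function. For $\alpha_1>0$ and $0\le d<1$, the stick-breaking weights of the two-parameter Poisson--Dirichlet process $\mathrm{PDP}(\alpha_1,d)$ are the random variables $\pi_1=V_1$ and $\pi_h=V_h\prod_{t=1}^{h-1}(1-V_t)$ for $h=2,3,\dots$, where $V_1,V_2,\dots$ are independent and $V_h\sim\mathrm{beta}(1-d,\alpha_1+hd)$. For $d=0$, where the process is the Dirichlet process with mass parameter $\alpha_1$ and the $V_h$ are i.i.d. $\mathrm{beta}(1,\alpha_1)$, the weights are denoted $\pi_h^*$. (1) Let $0<d<1$. The sequence $(\pi_h)_{h\ge1}$ does not have the law of the stick-breaking weights of a Dirichlet process with any mass parameter $\alpha'>0$. Moreover: (a) For every $h\ge1$, $\log\pi_h$ is square integrable and $E(\log\pi_h)=\psi(1-d)-\psi(\alpha_1)+\frac1d\bigl(\psi(\alpha_1/d)-\psi(\alpha_1/d+h)\bigr)$. Also $\lim_{h\to\infty}E(\log\pi_h)=-\infty$. (b) For every $h\ge1$, $\mathrm{Var}(\log\pi_h)=\psi_1(1-d)-\psi_1(\alpha_1)+\frac1{d^2}\bigl(\psi_1(\alpha_1/d)-\psi_1(\alpha_1/d+h)\bigr)$.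 The limit $\lim_{h\to\infty}\mathrm{Var}(\log\pi_h)$ exists and is finite. (c) $\dfrac{\log\pi_h}{\log(h^{-1/d})}\to1$ in probability as $h\to\infty$. (2) Let $d=0$. Then: (a) For every $h\ge1$, $\log\pi_h^*$ is square integrable and $E(\log\pi_h^*)=\psi(1)-\psi(\alpha_1)-h/\alpha_1$. Also $\lim_{h\to\infty}E(\log\pi_h^*)=-\infty$. (b) For every $h\ge1$, $\mathrm{Var}(\log\pi_h^*)=\psi_1(1)-\psi_1(\alpha_1)+h/\alpha_1^2$. Also $\lim_{h\to\infty}\mathrm{Var}(\log\pi_h^*)=\infty$. (c) As $h\to\infty$, $\sqrt h\left(\frac1h\log\pi_h^*+\frac1{\alpha_1}\right)\to N(0,1/\alpha_1^2)$ in distribution. Moreover $\pi_h^*$ is equivalent to $e^{-h/\alpha_1}$ on the logarithmic scale: $\dfrac{\log\pi_h^*}{\log(e^{-h/\alpha_1})}\to1$ in probability. (3) Let $0<d<1$, and let $(\pi_h)$ and $(\pi_h^*)$ be stick-breaking weights of $\mathrm{PDP}(\alpha_1,d)$ and of $\mathrm{PDP}(\alpha_1,0)$, defined on the same probability space with an arbitrary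 joint distribution. As $h\to\infty$, $\sqrt h\left(\frac1h\log(\pi_h^*/\pi_h)+\frac1{\alpha_1}\right)\to N(0,1/\alpha_1^2)$ in distribution, and $\dfrac{\log(\pi_h^*/\pi_h)}{\log(e^{-h/\alpha_1})}\to1$ in probability. -/

import Mathlib

open MeasureTheory ProbabilityTheory Filter Topology

namespace StickBreaking

/-- The digamma function `ψ(x) = d log Γ(x) / dx` of a real variable. -/
noncomputable def digamma (x : ℝ) : ℝ :=
  deriv (fun y : ℝ => Real.log (Real.Gamma y)) x

/-- The trigamma function `ψ₁(x) = d² log Γ(x) / dx²` of a real variable. -/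
noncomputable def trigamma (x : ℝ) : ℝ :=
  iteratedDeriv 2 (fun y : ℝ => Real.log (Real.Gamma y)) x

/-- `V 1, V 2, V 3, …` are stick-breaking fractions of the two-parameter Poisson-Dirichlet process
with mass parameter `α` and discount parameter `d`: independent, with `V h` distributed as
`beta(1 - d, α + h d)`. For `d = 0` they are i.i.d. `beta(1, α)`, as for the Dirichlet process.
Nothing is asked of `V 0`, which plays no role. -/
structure IsPDPFractions {Ω : Type*} [MeasurableSpace Ω] (P : Measure Ω) (α d : ℝ)
    (V : ℕ → Ω → ℝ) : Prop where
  hasLaw : ∀ h : ℕ, 1 ≤ h → HasLaw (V h) (betaMeasure (1 - d) (α + h * d)) P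
  indep : iIndepFun (fun t : ℕ => V (t + 1)) P

/-- The stick-breaking weights `π_h = V_h ∏_{t=1}^{h-1} (1 - V_t)`, for `h = 1, 2, 3, …`. -/
noncomputable def weight {Ω : Type*} (V : ℕ → Ω → ℝ) (h : ℕ) (ω : Ω) : ℝ :=
  V h ω * ∏ t ∈ Finset.Ico 1 h, (1 - V t ω)

end StickBreaking

namespace StickBreaking

/-! Almost surely every fraction lies in (0,1), so `log π_h` is a sum of h independent terms: `log
(1 - V_t)` for t < h, and `log V_h`. The moment generating function of the logarithm of a beta
variable is a ratio of beta functions, so its cumulant generating function is a difference of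
shifted `log Γ`'s plus a constant, and its mean and variance are differences of digamma and trigamma
values (`moments_of_cgf_eq`).

The parameters of V_{t+1} add up to α + t d + 1, one more than the number α + t d that already
governs V_t. With ψ(x + 1) = ψ(x) + 1/x and its analogue for ψ₁, the contributions telescope. For
every 0 ≤ d < 1 the mean is ψ(1 - d) - ψ(α) - ∑_{t<h} 1/(α + t d), and the variance has the same
shape with ψ₁ and + 1/(α + t d)² (`moments_log_weight_succ`).

For d > 0 the first sum grows like (1/d) log h and the second converges; for d = 0 they equal h/α
and h/α². All the convergences in probability then follow from Chebyshev's inequality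
(`tendstoInMeasure_div_of_variance`), and the bounded and unbounded variances tell the two kinds of
process apart. For d = 0 asymptotic normality is the central limit theorem for the i.i.d. `log (1 -
V_t)`, with Slutsky's theorem to correct the last term. For d > 0, `log π_h` is o(√h) in
probability, so by Slutsky again it does not affect the limit of the ratio, whatever the joint law.
-/

/-! ### Smoothness of `log Γ` and the recurrences of digamma and trigamma. -/

/-- The complex Γ is holomorphic on the open right half-plane, hence analytic there, and the real Γ
is its real part along the real axis. -/
lemma analyticAt_log_Gamma {x : ℝ} (hx : 0 < x) :
    AnalyticAt ℝ (fun y : ℝ => Real.log (Real.Gamma y)) x := by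
  have hC : AnalyticAt ℂ Complex.Gamma (x : ℂ) := by
    have hd : DifferentiableOn ℂ Complex.Gamma {s : ℂ | 0 < s.re} := by
      intro s hs
      refine (Complex.differentiableAt_Gamma s fun m hm => ?_).differentiableWithinAt
      have : s.re = -(m : ℝ) := by simp [hm]
      have h0 : 0 < s.re := hs
      have : (0 : ℝ) ≤ m := m.cast_nonneg
      linarith
    exact hd.analyticAt ((isOpen_lt continuous_const Complex.continuous_re).mem_nhds
      (by simpa using hx))
  have hR : AnalyticAt ℝ Real.Gamma x := by
    have := hC.re_ofReal
    simpa [Complex.Gamma_ofReal] using this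
  exact hR.log (Real.Gamma_pos_of_pos hx)

lemma log_Gamma_add_one {x : ℝ} (hx : 0 < x) :
    Real.log (Real.Gamma (x + 1)) = Real.log x + Real.log (Real.Gamma x) := by
  rw [Real.Gamma_add_one hx.ne', Real.log_mul hx.ne' (Real.Gamma_pos_of_pos hx).ne']

lemma trigamma_eq_deriv (x : ℝ) : trigamma x = deriv digamma x := by
  rw [trigamma, iteratedDeriv_succ, iteratedDeriv_one]
  rfl

lemma differentiableAt_digamma {x : ℝ} (hx : 0 < x) : DifferentiableAt ℝ digamma x :=
  (analyticAt_log_Gamma hx).deriv.differentiableAt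

lemma digamma_add_one {x : ℝ} (hx : 0 < x) : digamma (x + 1) = digamma x + 1 / x := by
  have h : (fun y : ℝ => Real.log (Real.Gamma (y + 1))) =ᶠ[𝓝 x]
      fun y => Real.log y + Real.log (Real.Gamma y) := by
    filter_upwards [lt_mem_nhds hx] with y hy using log_Gamma_add_one hy
  have h1 := h.deriv_eq
  rw [deriv_comp_add_const (f := fun y : ℝ => Real.log (Real.Gamma y)),
    deriv_fun_add (Real.differentiableAt_log hx.ne')
      (analyticAt_log_Gamma hx).differentiableAt, Real.deriv_log] at h1
  rw [digamma, h1, digamma]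
  ring

lemma trigamma_add_one {x : ℝ} (hx : 0 < x) : trigamma (x + 1) = trigamma x - 1 / x ^ 2 := by
  have h : (fun y : ℝ => digamma (y + 1)) =ᶠ[𝓝 x] fun y => digamma y + y⁻¹ := by
    filter_upwards [lt_mem_nhds hx] with y hy
    rw [digamma_add_one hy, one_div]
  have h1 := h.deriv_eq
  rw [deriv_comp_add_const (f := digamma), deriv_fun_add (differentiableAt_digamma hx)
    (differentiableAt_inv hx.ne'), deriv_inv] at h1
  rw [trigamma_eq_deriv, h1, trigamma_eq_deriv]
  ring

lemma digamma_add_nat {x : ℝ} (hx : 0 < x) (n : ℕ) :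
    digamma (x + n) = digamma x + ∑ t ∈ Finset.range n, 1 / (x + t) := by
  induction n with
  | zero => simp
  | succ n ih =>
    rw [Finset.sum_range_succ, ← add_assoc, ← ih, ← digamma_add_one (by positivity)]
    push_cast; ring_nf

lemma trigamma_add_nat {x : ℝ} (hx : 0 < x) (n : ℕ) :
    trigamma (x + n) = trigamma x - ∑ t ∈ Finset.range n, 1 / (x + t) ^ 2 := by
  induction n with
  | zero => simp
  | succ n ih =>
    rw [Finset.sum_range_succ, ← sub_sub, ← ih, ← trigamma_add_one (by positivity)]
    push_cast; ring_nf

/-! ### Moments of the logarithms of a beta variable -/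

lemma measurable_betaPDF (a b : ℝ) : Measurable (betaPDF a b) :=
  (measurable_betaPDFReal a b).ennreal_ofReal

lemma ae_betaMeasure_mem_Ioo (a b : ℝ) : ∀ᵐ x ∂(betaMeasure a b), x ∈ Set.Ioo (0 : ℝ) 1 := by
  rw [betaMeasure, ae_withDensity_iff (measurable_betaPDF a b)]
  refine Eventually.of_forall fun x hx => ?_
  by_contra h
  exact hx (by simp [betaPDF_eq, show ¬(0 < x ∧ x < 1) from h])

/-- Exponential tilting: a factor that turns one beta density into c times another must integrate to
c. The hypothesis `h` is abstract so as to serve both `log x` and `log (1 - x)`. -/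
lemma lintegral_exp_betaMeasure {a b a' b' t c : ℝ} (ha' : 0 < a') (hb' : 0 < b') (hc : 0 ≤ c) {f : ℝ → ℝ} (hf : Measurable f)
    (h : ∀ x, Real.exp (t * f x) * betaPDFReal a b x = c * betaPDFReal a' b' x) :
    ∫⁻ x, ENNReal.ofReal (Real.exp (t * f x)) ∂(betaMeasure a b) = ENNReal.ofReal c := by
  rw [betaMeasure, lintegral_withDensity_eq_lintegral_mul _ (measurable_betaPDF a b)
    (by fun_prop)]
  have : ∀ x, (betaPDF a b * fun x => ENNReal.ofReal (Real.exp (t * f x))) x =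
      ENNReal.ofReal c * betaPDF a' b' x := by
    intro x
    rw [Pi.mul_apply, mul_comm, betaPDF, betaPDF, ← ENNReal.ofReal_mul (Real.exp_pos _).le, h,
      ENNReal.ofReal_mul hc]
  simp_rw [this]
  rw [lintegral_const_mul _ (measurable_betaPDF a' b'), lintegral_betaPDF_eq_one ha' hb', mul_one]

lemma integrable_exp_betaMeasure {a b a' b' t c : ℝ} (ha' : 0 < a') (hb' : 0 < b') (hc : 0 ≤ c) {f : ℝ → ℝ} (hf : Measurable f)
    (h : ∀ x, Real.exp (t * f x) * betaPDFReal a b x = c * betaPDFReal a' b' x) :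
    Integrable (fun x => Real.exp (t * f x)) (betaMeasure a b) := by
  rw [← lintegral_ofReal_ne_top_iff_integrable (by fun_prop)
    (Eventually.of_forall fun x => (Real.exp_pos _).le),
    lintegral_exp_betaMeasure ha' hb' hc hf h]
  exact ENNReal.ofReal_ne_top

lemma mgf_betaMeasure {a b a' b' t c : ℝ} (ha' : 0 < a') (hb' : 0 < b') (hc : 0 ≤ c) {f : ℝ → ℝ} (hf : Measurable f)
    (h : ∀ x, Real.exp (t * f x) * betaPDFReal a b x = c * betaPDFReal a' b' x) :
    mgf f (betaMeasure a b) t = c := by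
  rw [mgf, integral_eq_lintegral_of_nonneg_ae (Eventually.of_forall fun x => (Real.exp_pos _).le)
    (by fun_prop), lintegral_exp_betaMeasure ha' hb' hc hf h, ENNReal.toReal_ofReal hc]

lemma exp_log_mul_betaPDFReal {a b t : ℝ} (ha : 0 < a) (hb : 0 < b) (ht : 0 < a + t) (x : ℝ) :
    Real.exp (t * Real.log x) * betaPDFReal a b x =
      beta (a + t) b / beta a b * betaPDFReal (a + t) b x := by
  by_cases h : 0 < x ∧ x < 1
  · have h1 := beta_pos ha hb
    have h2 := beta_pos ht hb
    simp only [betaPDFReal, if_pos h]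
    rw [show a + t - 1 = t + (a - 1) by ring, Real.rpow_add h.1, Real.rpow_def_of_pos h.1 t,
      mul_comm t]
    field_simp
  · simp [betaPDFReal, h]

lemma exp_log_one_sub_mul_betaPDFReal {a b t : ℝ} (ha : 0 < a) (hb : 0 < b) (ht : 0 < b + t)
    (x : ℝ) :
    Real.exp (t * Real.log (1 - x)) * betaPDFReal a b x =
      beta a (b + t) / beta a b * betaPDFReal a (b + t) x := by
  by_cases h : 0 < x ∧ x < 1
  · have h1 := beta_pos ha hb
    have h2 := beta_pos ha ht
    have h3 : 0 < 1 - x := by linarith [h.2]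
    simp only [betaPDFReal, if_pos h]
    rw [show b + t - 1 = t + (b - 1) by ring, Real.rpow_add h3, Real.rpow_def_of_pos h3 t,
      mul_comm t]
    field_simp
  · simp [betaPDFReal, h]

/-- If the cumulant generating function of `X` is `t ↦ log Γ(p + t) - log Γ(q + t) + C` near `0`,
then `X` has mean `ψ(p) - ψ(q)` and variance `ψ₁(p) - ψ₁(q)`. -/
lemma moments_of_cgf_eq {Ω : Type*} [MeasurableSpace Ω] {P : Measure Ω} [IsProbabilityMeasure P]
    {X : Ω → ℝ} {p q C : ℝ} (hp : 0 < p) (hq : 0 < q) (hX : 0 ∈ interior (integrableExpSet X P))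
    (h : cgf X P =ᶠ[𝓝 0] fun t => Real.log (Real.Gamma (p + t)) -
      Real.log (Real.Gamma (q + t)) + C) :
    MemLp X 2 P ∧ ∫ ω, X ω ∂P = digamma p - digamma q ∧
      variance X P = trigamma p - trigamma q := by
  have hd : ∀ {r t : ℝ}, 0 < r + t →
      HasDerivAt (fun t => Real.log (Real.Gamma (r + t))) (digamma (r + t)) t := by
    intro r t hr
    have := (analyticAt_log_Gamma hr).differentiableAt.hasDerivAt
    exact HasDerivAt.comp_const_add r t this
  have hd' : ∀ {r : ℝ}, 0 < r → HasDerivAt (fun t => digamma (r + t)) (trigamma r) 0 := by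
    intro r hr
    have := (differentiableAt_digamma hr).hasDerivAt
    rw [← trigamma_eq_deriv] at this
    refine HasDerivAt.comp_const_add r 0 ?_
    simpa using this
  -- An equality near 0, not just at 0, because it is differentiated once more for the variance.
  have h1 : deriv (cgf X P) =ᶠ[𝓝 0] fun t => digamma (p + t) - digamma (q + t) := by
    have hp' : ∀ᶠ t in 𝓝 (0 : ℝ), 0 < p + t :=
      (continuous_const.add continuous_id).continuousAt.eventually_mem
        (lt_mem_nhds (by simpa using hp))
    have hq' : ∀ᶠ t in 𝓝 (0 : ℝ), 0 < q + t :=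
      (continuous_const.add continuous_id).continuousAt.eventually_mem
        (lt_mem_nhds (by simpa using hq))
    filter_upwards [hp', hq', h.deriv] with t htp htq ht
    rw [ht]
    exact (((hd htp).sub (hd htq)).add_const C).deriv
  have hmem : MemLp X 2 P := by simpa using memLp_of_mem_interior_integrableExpSet hX 2
  refine ⟨hmem, ?_, ?_⟩
  · have := deriv_cgf_zero hX
    simp only [probReal_univ, div_one] at this
    rw [← this, h1.eq_of_nhds]
    simp
  · have h2 : iteratedDeriv 2 (cgf X P) 0 = trigamma p - trigamma q := by
      rw [iteratedDeriv_succ, iteratedDeriv_one, h1.deriv_eq]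
      exact ((hd' hp).sub (hd' hq)).deriv
    rw [← h2, iteratedDeriv_two_cgf_eq_integral hX, deriv_cgf_zero hX,
      variance_eq_integral hmem.aemeasurable]
    simp

lemma moments_log_beta {a b : ℝ} (ha : 0 < a) (hb : 0 < b) :
    MemLp Real.log 2 (betaMeasure a b) ∧
      ∫ x, Real.log x ∂(betaMeasure a b) = digamma a - digamma (a + b) ∧
      variance Real.log (betaMeasure a b) = trigamma a - trigamma (a + b) := by
  have := isProbabilityMeasureBeta ha hb
  -- For t > -a the tilted density is again a beta density. The constant C collects the factors of
  -- B(a + t, b) / B(a, b) that do not involve t.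
  have hI : Set.Ioi (-a) ∈ 𝓝 (0 : ℝ) := Ioi_mem_nhds (by linarith)
  refine moments_of_cgf_eq (C := Real.log (Real.Gamma b) - Real.log (beta a b)) ha (by positivity)
    ?_ ?_
  · refine mem_interior_iff_mem_nhds.2 (mem_of_superset hI fun t ht => ?_)
    have ht : 0 < a + t := by simp at ht; linarith
    exact integrable_exp_betaMeasure ht hb (div_pos (beta_pos ht hb) (beta_pos ha hb)).le
      Real.measurable_log (exp_log_mul_betaPDFReal ha hb ht)
  · filter_upwards [hI] with t ht
    have ht : 0 < a + t := by simp at ht; linarith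
    rw [cgf, mgf_betaMeasure ht hb (div_pos (beta_pos ht hb) (beta_pos ha hb)).le
      Real.measurable_log (exp_log_mul_betaPDFReal ha hb ht),
      Real.log_div (beta_pos ht hb).ne' (beta_pos ha hb).ne', beta, Real.log_div, Real.log_mul,
      show a + t + b = a + b + t by ring]
    · ring
    all_goals have := Real.Gamma_pos_of_pos ht; have := Real.Gamma_pos_of_pos hb
    all_goals have := Real.Gamma_pos_of_pos (add_pos ht hb); positivity

lemma moments_log_one_sub_beta {a b : ℝ} (ha : 0 < a) (hb : 0 < b) :
    MemLp (fun x => Real.log (1 - x)) 2 (betaMeasure a b) ∧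
      ∫ x, Real.log (1 - x) ∂(betaMeasure a b) = digamma b - digamma (a + b) ∧
      variance (fun x => Real.log (1 - x)) (betaMeasure a b) = trigamma b - trigamma (a + b) := by
  have := isProbabilityMeasureBeta ha hb
  have hI : Set.Ioi (-b) ∈ 𝓝 (0 : ℝ) := Ioi_mem_nhds (by linarith)
  have hm : Measurable fun x : ℝ => Real.log (1 - x) := by fun_prop
  refine moments_of_cgf_eq (C := Real.log (Real.Gamma a) - Real.log (beta a b)) hb (by positivity)
    ?_ ?_
  · refine mem_interior_iff_mem_nhds.2 (mem_of_superset hI fun t ht => ?_)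
    have ht : 0 < b + t := by simp at ht; linarith
    exact integrable_exp_betaMeasure ha ht (div_pos (beta_pos ha ht) (beta_pos ha hb)).le
      hm (exp_log_one_sub_mul_betaPDFReal ha hb ht)
  · filter_upwards [hI] with t ht
    have ht : 0 < b + t := by simp at ht; linarith
    rw [cgf, mgf_betaMeasure ha ht (div_pos (beta_pos ha ht) (beta_pos ha hb)).le
      hm (exp_log_one_sub_mul_betaPDFReal ha hb ht),
      Real.log_div (beta_pos ha ht).ne' (beta_pos ha hb).ne', beta, Real.log_div, Real.log_mul,
      ← add_assoc]
    · ring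
    all_goals have := Real.Gamma_pos_of_pos ht; have := Real.Gamma_pos_of_pos ha
    all_goals have := Real.Gamma_pos_of_pos (add_pos ha ht); positivity

/-! ### Convergence in probability -/

section InMeasure

variable {Ω : Type*} [MeasurableSpace Ω] {P : Measure Ω}

/-- Chebyshev: if the means of `X n / c n` converge to `m` and their variances to `0`, then
`X n / c n` converges to `m` in probability. -/
lemma tendstoInMeasure_div_of_variance [IsFiniteMeasure P] {X : ℕ → Ω → ℝ} {c : ℕ → ℝ} {m : ℝ}
    (hX : ∀ᶠ n in atTop, MemLp (X n) 2 P)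
    (hm : Tendsto (fun n => (∫ ω, X n ω ∂P) / c n) atTop (𝓝 m))
    (hv : Tendsto (fun n => variance (X n) P / c n ^ 2) atTop (𝓝 0)) :
    TendstoInMeasure P (fun n ω => X n ω / c n) atTop (fun _ => m) := by
  rw [tendstoInMeasure_iff_dist]
  intro ε hε
  have hlim : Tendsto (fun n => ENNReal.ofReal (variance (X n) P / c n ^ 2 / (ε / 2) ^ 2))
      atTop (𝓝 0) := by
    simpa using ENNReal.tendsto_ofReal (hv.div_const ((ε / 2) ^ 2))
  refine tendsto_of_tendsto_of_tendsto_of_le_of_le' tendsto_const_nhds hlim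
    (Eventually.of_forall fun _ => zero_le) ?_
  filter_upwards [hX, Metric.tendsto_nhds.1 hm (ε / 2) (by positivity)] with n hn hmn
  have hL : MemLp (fun ω => X n ω / c n) 2 P := by
    simpa [div_eq_mul_inv] using hn.mul_const (c n)⁻¹
  have hE : ∫ ω, X n ω / c n ∂P = (∫ ω, X n ω ∂P) / c n := integral_div _ _
  have hV : variance (fun ω => X n ω / c n) P = variance (X n) P / c n ^ 2 := by
    have := variance_const_mul (c n)⁻¹ (X n) P
    simp_rw [div_eq_mul_inv, mul_comm _ (c n)⁻¹]
    rw [this, inv_pow, mul_comm]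
  rw [← hV]
  refine le_trans (measure_mono fun ω hω => ?_)
    (meas_ge_le_variance_div_sq hL (c := ε / 2) (by positivity))
  simp only [Set.mem_ofPred_eq] at hω ⊢
  rw [hE, ← Real.dist_eq]
  have := dist_triangle (X n ω / c n) ((∫ ω, X n ω ∂P) / c n) m
  linarith

/-- A union bound on two deviations of ε/2; neither measurability nor any knowledge of the joint law
enters. -/
lemma tendstoInMeasure_sub {X Y : ℕ → Ω → ℝ} {a b : ℝ}
    (hX : TendstoInMeasure P X atTop (fun _ => a)) (hY : TendstoInMeasure P Y atTop (fun _ => b)) :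
    TendstoInMeasure P (fun n ω => X n ω - Y n ω) atTop (fun _ => a - b) := by
  rw [tendstoInMeasure_iff_dist] at hX hY ⊢
  intro ε hε
  have := (hX (ε / 2) (by positivity)).add (hY (ε / 2) (by positivity))
  rw [add_zero] at this
  refine tendsto_of_tendsto_of_tendsto_of_le_of_le tendsto_const_nhds this
    (fun _ => zero_le) fun n => ?_
  refine le_trans (measure_mono fun ω hω => ?_) (measure_union_le _ _)
  by_contra h
  simp only [Set.mem_union, Set.mem_ofPred_eq, not_or, not_le] at h hω
  have := dist_sub_sub_le (X n ω) (Y n ω) a b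
  linarith [h.1, h.2]

end InMeasure

/-! ### Means and variances of the logarithms of the weights -/

lemma weight_succ {Ω : Type*} (V : ℕ → Ω → ℝ) (n : ℕ) (ω : Ω) :
    weight V (n + 1) ω = V (n + 1) ω * ∏ t ∈ Finset.range n, (1 - V (t + 1) ω) := by
  rw [weight, Finset.prod_Ico_eq_prod_range]
  simp [add_comm]

section Moments

variable {Ω : Type*} [MeasurableSpace Ω] {P : Measure Ω}

lemma moments_comp_of_hasLaw {μ : Measure ℝ} {X : Ω → ℝ} (hX : HasLaw X μ P) {f : ℝ → ℝ}
    (hf : MemLp f 2 μ) :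
    MemLp (fun ω => f (X ω)) 2 P ∧ ∫ ω, f (X ω) ∂P = ∫ x, f x ∂μ ∧
      variance (fun ω => f (X ω)) P = variance f μ := by
  refine ⟨?_, hX.integral_comp hf.aestronglyMeasurable, ?_⟩
  · rw [← hX.map_eq] at hf
    exact hf.comp_of_map hX.aemeasurable
  · rw [← hX.map_eq] at hf ⊢
    exact (variance_map hf.aemeasurable hX.aemeasurable).symm

variable {α d : ℝ} {V : ℕ → Ω → ℝ}

lemma IsPDPFractions.ae_mem_Ioo (hV : IsPDPFractions P α d V) :
    ∀ᵐ ω ∂P, ∀ n, V (n + 1) ω ∈ Set.Ioo (0 : ℝ) 1 :=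
  ae_all_iff.2 fun n => ((hV.hasLaw (n + 1) (by omega)).ae_iff
    (by exact measurableSet_Ioo.mem)).2 (ae_betaMeasure_mem_Ioo _ _)

lemma IsPDPFractions.ae_weight_pos (hV : IsPDPFractions P α d V) :
    ∀ᵐ ω ∂P, ∀ n, 0 < weight V (n + 1) ω := by
  filter_upwards [hV.ae_mem_Ioo] with ω hω n
  rw [weight_succ]
  exact mul_pos (hω n).1 (Finset.prod_pos fun t _ => sub_pos.2 (hω t).2)

lemma IsPDPFractions.ae_log_weight (hV : IsPDPFractions P α d V) :
    ∀ᵐ ω ∂P, ∀ n, Real.log (weight V (n + 1) ω) =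
      ∑ t ∈ Finset.range n, Real.log (1 - V (t + 1) ω) + Real.log (V (n + 1) ω) := by
  filter_upwards [hV.ae_mem_Ioo] with ω hω n
  have h1 : ∀ t, 1 - V (t + 1) ω ≠ 0 := fun t => (sub_pos.2 (hω t).2).ne'
  rw [weight_succ, Real.log_mul (hω n).1.ne' (Finset.prod_ne_zero_iff.2 fun t _ => h1 t),
    Real.log_prod fun t _ => h1 t, add_comm]

lemma IsPDPFractions.moments_log (hV : IsPDPFractions P α d V) (hα : 0 < α) (hd : 0 ≤ d)
    (hd1 : d < 1) (n : ℕ) :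
    MemLp (fun ω => Real.log (V (n + 1) ω)) 2 P ∧
      ∫ ω, Real.log (V (n + 1) ω) ∂P =
        digamma (1 - d) - digamma (α + n * d) - 1 / (α + n * d) ∧
      variance (fun ω => Real.log (V (n + 1) ω)) P =
        trigamma (1 - d) - trigamma (α + n * d) + 1 / (α + n * d) ^ 2 := by
  have ha : 0 < 1 - d := by linarith
  have hb : 0 < α + (n + 1 : ℕ) * d := by positivity
  have hc : 0 < α + n * d := by positivity
  have hab : 1 - d + (α + (n + 1 : ℕ) * d) = α + n * d + 1 := by push_cast; ring
  obtain ⟨h1, h2, h3⟩ := moments_log_beta ha hb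
  obtain ⟨g1, g2, g3⟩ := moments_comp_of_hasLaw (hV.hasLaw (n + 1) (by omega)) h1
  refine ⟨g1, ?_, ?_⟩
  · rw [g2, h2, hab, digamma_add_one hc]; ring
  · rw [g3, h3, hab, trigamma_add_one hc]; ring

/-- The recurrence is applied at the parameter sum α + n d + 1, so that the digamma and trigamma
terms become increments in n, ready to telescope. -/
lemma IsPDPFractions.moments_log_one_sub (hV : IsPDPFractions P α d V) (hα : 0 < α) (hd : 0 ≤ d)
    (hd1 : d < 1) (n : ℕ) :
    MemLp (fun ω => Real.log (1 - V (n + 1) ω)) 2 P ∧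
      ∫ ω, Real.log (1 - V (n + 1) ω) ∂P =
        digamma (α + (n + 1 : ℕ) * d) - digamma (α + n * d) - 1 / (α + n * d) ∧
      variance (fun ω => Real.log (1 - V (n + 1) ω)) P =
        trigamma (α + (n + 1 : ℕ) * d) - trigamma (α + n * d) + 1 / (α + n * d) ^ 2 := by
  have ha : 0 < 1 - d := by linarith
  have hb : 0 < α + (n + 1 : ℕ) * d := by positivity
  have hc : 0 < α + n * d := by positivity
  have hab : 1 - d + (α + (n + 1 : ℕ) * d) = α + n * d + 1 := by push_cast; ring
  obtain ⟨h1, h2, h3⟩ := moments_log_one_sub_beta ha hb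
  obtain ⟨g1, g2, g3⟩ := moments_comp_of_hasLaw (hV.hasLaw (n + 1) (by omega)) h1
  refine ⟨g1, ?_, ?_⟩
  · rw [g2, h2, hab, digamma_add_one hc]; ring
  · rw [g3, h3, hab, trigamma_add_one hc]; ring

lemma IsPDPFractions.moments_log_weight_succ (hV : IsPDPFractions P α d V) (hα : 0 < α)
    (hd : 0 ≤ d) (hd1 : d < 1) (n : ℕ) :
    MemLp (fun ω => Real.log (weight V (n + 1) ω)) 2 P ∧
      ∫ ω, Real.log (weight V (n + 1) ω) ∂P =
        digamma (1 - d) - digamma α - ∑ t ∈ Finset.range (n + 1), 1 / (α + t * d) ∧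
      variance (fun ω => Real.log (weight V (n + 1) ω)) P =
        trigamma (1 - d) - trigamma α + ∑ t ∈ Finset.range (n + 1), 1 / (α + t * d) ^ 2 := by
  have := hV.indep.isProbabilityMeasure
  -- Putting `log x` at index n and `log (1 - x)` elsewhere presents all the summands as one
  -- independent family of functions of the fractions.
  let g : ℕ → ℝ → ℝ := fun t x => if t = n then Real.log x else Real.log (1 - x)
  let Z : ℕ → Ω → ℝ := fun t ω => g t (V (t + 1) ω)
  have hg : ∀ t, Measurable (g t) := by
    intro t
    by_cases h : t = n
    · simp only [g, h, if_true]; fun_prop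
    · simp only [g, h, if_false]; fun_prop
  have hZn : Z n = fun ω => Real.log (V (n + 1) ω) := by ext ω; simp [Z, g]
  have hZt : ∀ t ∈ Finset.range n, Z t = fun ω => Real.log (1 - V (t + 1) ω) := by
    intro t ht
    ext ω
    simp [Z, g, (Finset.mem_range.1 ht).ne]
  have hZm : ∀ t ∈ Finset.range (n + 1), MemLp (Z t) 2 P := by
    intro t ht
    rw [Finset.range_add_one, Finset.mem_insert] at ht
    rcases ht with rfl | ht
    · rw [hZn]; exact (hV.moments_log hα hd hd1 _).1
    · rw [hZt t ht]; exact (hV.moments_log_one_sub hα hd hd1 _).1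
  have hind : iIndepFun Z P := hV.indep.comp g hg
  have heq : (fun ω => Real.log (weight V (n + 1) ω)) =ᵐ[P] ∑ t ∈ Finset.range (n + 1), Z t := by
    filter_upwards [hV.ae_log_weight] with ω hω
    rw [hω n, Finset.sum_range_succ, hZn, Finset.sum_congr rfl hZt]
    simp
  have htel : ∀ f : ℝ → ℝ, ∑ t ∈ Finset.range n, (f (α + (t + 1 : ℕ) * d) - f (α + t * d)) =
      f (α + n * d) - f α := by
    intro f
    rw [Finset.sum_range_sub (fun t : ℕ => f (α + t * d))]
    simp
  refine ⟨(memLp_finsetSum' _ hZm).ae_eq heq.symm, ?_, ?_⟩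
  · rw [integral_congr_ae heq]
    simp only [Finset.sum_apply]
    rw [integral_finsetSum _ fun t ht => (hZm t ht).integrable (by norm_num),
      Finset.sum_range_succ, hZn, (hV.moments_log hα hd hd1 n).2.1,
      Finset.sum_congr rfl fun t ht => (congrArg (fun f => ∫ ω, f ω ∂P) (hZt t ht)).trans
        (hV.moments_log_one_sub hα hd hd1 t).2.1,
      Finset.sum_sub_distrib, htel digamma, Finset.sum_range_succ]
    ring
  · rw [variance_congr heq, IndepFun.variance_sum hZm fun i _ j _ hij => hind.indepFun hij,
      Finset.sum_range_succ, hZn, (hV.moments_log hα hd hd1 n).2.2,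
      Finset.sum_congr rfl fun t ht => (congrArg (fun f => variance f P) (hZt t ht)).trans
        (hV.moments_log_one_sub hα hd hd1 t).2.2,
      Finset.sum_add_distrib, htel trigamma, Finset.sum_range_succ]
    ring

lemma IsPDPFractions.moments_log_weight (hV : IsPDPFractions P α d V) (hα : 0 < α)
    (hd : 0 ≤ d) (hd1 : d < 1) {h : ℕ} (hh : 1 ≤ h) :
    MemLp (fun ω => Real.log (weight V h ω)) 2 P ∧
      ∫ ω, Real.log (weight V h ω) ∂P =
        digamma (1 - d) - digamma α - ∑ t ∈ Finset.range h, 1 / (α + t * d) ∧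
      variance (fun ω => Real.log (weight V h ω)) P =
        trigamma (1 - d) - trigamma α + ∑ t ∈ Finset.range h, 1 / (α + t * d) ^ 2 := by
  obtain ⟨n, rfl⟩ := Nat.exists_eq_add_of_le' hh
  exact hV.moments_log_weight_succ hα hd hd1 n

end Moments

/-! ### Asymptotics of the means and variances -/

section Asymptotics

variable {α d : ℝ}

/-- Bounds the denominators below by a multiple of t + 1, uniformly from t = 0 on, for comparison
with ∑ 1/(t + 1)². -/
lemma mul_succ_le_add_mul (α d : ℝ) (t : ℕ) : min α d * (t + 1) ≤ α + t * d := by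
  have h1 := min_le_left α d
  have h2 := mul_le_mul_of_nonneg_left (min_le_right α d) t.cast_nonneg (α := ℝ)
  linarith

lemma summable_one_div_succ_sq : Summable fun t : ℕ => 1 / ((t : ℝ) + 1) ^ 2 := by
  have := (summable_nat_add_iff 1).2 (Real.summable_one_div_nat_pow (p := 2).2 (by norm_num))
  simpa using this

lemma summable_one_div_add_mul_sq (hα : 0 < α) (hd : 0 < d) :
    Summable fun t : ℕ => 1 / (α + t * d) ^ 2 := by
  have hm : 0 < min α d := lt_min hα hd
  refine Summable.of_nonneg_of_le (fun t => by positivity) (fun t => ?_)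
    (summable_one_div_succ_sq.mul_left (1 / min α d ^ 2))
  rw [one_div_mul_one_div, ← mul_pow]
  have := mul_succ_le_add_mul α d t
  gcongr

/-- Termwise comparison with 1/d times the harmonic series: the differences are O(1/(t + 1)²), hence
summable, and the harmonic sum minus log h converges to Euler's constant. -/
lemma exists_tendsto_sum_sub_log (hα : 0 < α) (hd : 0 < d) :
    ∃ L, Tendsto (fun h : ℕ => ∑ t ∈ Finset.range h, 1 / (α + t * d) - 1 / d * Real.log h)
      atTop (𝓝 L) := by
  have hm : 0 < min α d := lt_min hα hd
  have hs : Summable fun t : ℕ => 1 / (α + t * d) - 1 / d * (1 / ((t : ℝ) + 1)) := by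
    refine Summable.of_norm_bounded
      (summable_one_div_succ_sq.mul_left (|d - α| / (d * min α d))) fun t => ?_
    have h1 : 1 / (α + t * d) - 1 / d * (1 / ((t : ℝ) + 1)) =
        (d - α) / (d * ((α + t * d) * (t + 1))) := by
      field_simp; ring
    rw [h1, Real.norm_eq_abs, abs_div, abs_of_pos (a := d * _) (by positivity),
      div_mul_div_comm, mul_one]
    have := mul_succ_le_add_mul α d t
    refine div_le_div_of_nonneg_left (abs_nonneg _) (by positivity) ?_
    calc d * min α d * ((t : ℝ) + 1) ^ 2 = d * ((min α d * (t + 1)) * (t + 1)) := by ring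
      _ ≤ _ := by gcongr
  refine ⟨_, (hs.hasSum.tendsto_sum_nat.add
    (Real.tendsto_harmonic_sub_log.const_mul (1 / d))).congr fun h => ?_⟩
  rw [Finset.sum_sub_distrib, ← Finset.mul_sum, harmonic]
  push_cast
  simp only [one_div]
  ring

lemma tendsto_log_natCast : Tendsto (fun h : ℕ => Real.log h) atTop atTop :=
  Real.tendsto_log_atTop.comp tendsto_natCast_atTop_atTop

lemma tendsto_log_div_sqrt : Tendsto (fun h : ℕ => Real.log h / √(h : ℝ)) atTop (𝓝 0) := by
  have := ((isLittleO_log_rpow_atTop (r := 1 / 2) (by norm_num)).tendsto_div_nhds_zero).comp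
    (tendsto_natCast_atTop_atTop (R := ℝ))
  simpa [Function.comp_def, Real.sqrt_eq_rpow] using this

lemma tendsto_sum_div_log (hα : 0 < α) (hd : 0 < d) :
    Tendsto (fun h : ℕ => (∑ t ∈ Finset.range h, 1 / (α + t * d)) / Real.log h) atTop
      (𝓝 (1 / d)) := by
  obtain ⟨L, hL⟩ := exists_tendsto_sum_sub_log hα hd
  have := (hL.div_atTop tendsto_log_natCast).add_const (1 / d)
  rw [zero_add] at this
  refine this.congr' ?_
  filter_upwards [tendsto_log_natCast.eventually_gt_atTop 0] with h hh
  rw [sub_div, mul_div_cancel_right₀ _ hh.ne', sub_add_cancel]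

lemma tendsto_sum_atTop (hα : 0 < α) (hd : 0 < d) :
    Tendsto (fun h : ℕ => ∑ t ∈ Finset.range h, 1 / (α + t * d)) atTop atTop := by
  obtain ⟨L, hL⟩ := exists_tendsto_sum_sub_log hα hd
  have := hL.add_atTop (tendsto_log_natCast.const_mul_atTop (r := 1 / d) (by positivity))
  simpa using this

/-- Factor d out of each denominator and iterate the digamma recurrence from α/d. -/
lemma sum_eq_digamma (hα : 0 < α) (hd : 0 < d) (h : ℕ) :
    -∑ t ∈ Finset.range h, 1 / (α + t * d) = 1 / d * (digamma (α / d) - digamma (α / d + h)) := by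
  rw [digamma_add_nat (by positivity), sub_add_cancel_left, mul_neg, Finset.mul_sum]
  congr 1
  refine Finset.sum_congr rfl fun t _ => ?_
  field_simp

lemma sum_eq_trigamma (hα : 0 < α) (hd : 0 < d) (h : ℕ) :
    ∑ t ∈ Finset.range h, 1 / (α + t * d) ^ 2 =
      1 / d ^ 2 * (trigamma (α / d) - trigamma (α / d + h)) := by
  rw [trigamma_add_nat (by positivity), sub_sub_cancel, Finset.mul_sum]
  refine Finset.sum_congr rfl fun t _ => ?_
  field_simp

end Asymptotics

/-! ### Limit theorems for the weights -/

section Limits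

variable {Ω : Type*} [MeasurableSpace Ω] {P : Measure Ω} {α d : ℝ}
  {V W : ℕ → Ω → ℝ}

lemma IsPDPFractions.eventually_memLp (hV : IsPDPFractions P α d V) (hα : 0 < α) (hd : 0 ≤ d)
    (hd1 : d < 1) : ∀ᶠ h : ℕ in atTop, MemLp (fun ω => Real.log (weight V h ω)) 2 P := by
  filter_upwards [eventually_ge_atTop 1] with h hh using (hV.moments_log_weight hα hd hd1 hh).1

lemma IsPDPFractions.aemeasurable_weight (hV : IsPDPFractions P α d V) {h : ℕ} (hh : 1 ≤ h) :
    AEMeasurable (fun ω => weight V h ω) P := by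
  have := fun n : ℕ => (hV.hasLaw (n + 1) (by omega)).aemeasurable
  obtain ⟨n, rfl⟩ := Nat.exists_eq_add_of_le' hh
  simp_rw [weight_succ]
  fun_prop

lemma IsPDPFractions.tendsto_mean_atBot (hV : IsPDPFractions P α d V) (hα : 0 < α) (hd : 0 < d)
    (hd1 : d < 1) :
    Tendsto (fun h : ℕ => ∫ ω, Real.log (weight V h ω) ∂P) atTop atBot := by
  refine Tendsto.congr' ?_ (tendsto_atBot_add_const_left _ (digamma (1 - d) - digamma α)
    (tendsto_neg_atTop_atBot.comp (tendsto_sum_atTop hα hd)))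
  filter_upwards [eventually_ge_atTop 1] with h hh
  rw [(hV.moments_log_weight hα hd.le hd1 hh).2.1]
  rfl

lemma IsPDPFractions.exists_tendsto_variance (hV : IsPDPFractions P α d V) (hα : 0 < α)
    (hd : 0 < d) (hd1 : d < 1) :
    ∃ L : ℝ, Tendsto (fun h : ℕ => variance (fun ω => Real.log (weight V h ω)) P)
      atTop (𝓝 L) := by
  refine ⟨_, Tendsto.congr' ?_ ((summable_one_div_add_mul_sq hα hd).hasSum.tendsto_sum_nat.const_add
    (trigamma (1 - d) - trigamma α))⟩
  filter_upwards [eventually_ge_atTop 1] with h hh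
  rw [(hV.moments_log_weight hα hd.le hd1 hh).2.2]

lemma IsPDPFractions.tendsto_mean_div_log (hV : IsPDPFractions P α d V) (hα : 0 < α) (hd : 0 < d)
    (hd1 : d < 1) :
    Tendsto (fun h : ℕ => (∫ ω, Real.log (weight V h ω) ∂P) / Real.log h) atTop
      (𝓝 (-(1 / d))) := by
  have := ((tendsto_const_nhds (x := digamma (1 - d) - digamma α)).div_atTop
    tendsto_log_natCast).sub (tendsto_sum_div_log hα hd)
  rw [zero_sub] at this
  refine Tendsto.congr' ?_ this
  filter_upwards [eventually_ge_atTop 1] with h hh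
  rw [(hV.moments_log_weight hα hd.le hd1 hh).2.1, ← sub_div]

lemma IsPDPFractions.moments_log_weight_zero (hV : IsPDPFractions P α 0 V) (hα : 0 < α)
    {h : ℕ} (hh : 1 ≤ h) :
    MemLp (fun ω => Real.log (weight V h ω)) 2 P ∧
      ∫ ω, Real.log (weight V h ω) ∂P = digamma 1 - digamma α - h / α ∧
      variance (fun ω => Real.log (weight V h ω)) P = trigamma 1 - trigamma α + h / α ^ 2 := by
  have := hV.moments_log_weight hα le_rfl one_pos hh
  simpa [div_eq_mul_inv] using this

lemma IsPDPFractions.ae_log_div (hV : IsPDPFractions P α d V) {α' d' : ℝ}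
    (hW : IsPDPFractions P α' d' W) {h : ℕ} (hh : 1 ≤ h) :
    ∀ᵐ ω ∂P, Real.log (weight W h ω / weight V h ω) =
      Real.log (weight W h ω) - Real.log (weight V h ω) := by
  obtain ⟨n, rfl⟩ := Nat.exists_eq_add_of_le' hh
  filter_upwards [hV.ae_weight_pos, hW.ae_weight_pos] with ω h1 h2
  rw [Real.log_div (h2 n).ne' (h1 n).ne']

lemma IsPDPFractions.aemeasurable_sqrt_mul (hV : IsPDPFractions P α d V) (h : ℕ) (r : ℝ) :
    AEMeasurable (fun ω => √(h : ℝ) * (1 / h * Real.log (weight V h ω) + r)) P := by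
  rcases Nat.eq_zero_or_pos h with rfl | hh
  · simp
  · have := hV.aemeasurable_weight hh
    fun_prop

lemma IsPDPFractions.tendsto_mean_zero (hV : IsPDPFractions P α 0 V) (hα : 0 < α) :
    Tendsto (fun h : ℕ => ∫ ω, Real.log (weight V h ω) ∂P) atTop atBot := by
  refine Tendsto.congr' ?_ (tendsto_atBot_add_const_left _ (digamma 1 - digamma α)
    (tendsto_neg_atTop_atBot.comp
      ((tendsto_natCast_atTop_atTop (R := ℝ)).atTop_div_const hα)))
  filter_upwards [eventually_ge_atTop 1] with h hh
  rw [(hV.moments_log_weight_zero hα hh).2.1]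
  rfl

lemma IsPDPFractions.tendsto_variance_zero (hV : IsPDPFractions P α 0 V) (hα : 0 < α) :
    Tendsto (fun h : ℕ => variance (fun ω => Real.log (weight V h ω)) P) atTop atTop := by
  refine Tendsto.congr' ?_ (tendsto_atTop_add_const_left _ (trigamma 1 - trigamma α)
    ((tendsto_natCast_atTop_atTop (R := ℝ)).atTop_div_const (show 0 < α ^ 2 by positivity)))
  filter_upwards [eventually_ge_atTop 1] with h hh
  rw [(hV.moments_log_weight_zero hα hh).2.2]

/-- The variances of the logarithms of the weights are bounded for positive discount, and
unbounded for the Dirichlet process. -/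
lemma IsPDPFractions.not_identDistrib {Ω' : Type*} [MeasurableSpace Ω'] {P' : Measure Ω'}
    {α' : ℝ} {W : ℕ → Ω' → ℝ} (hV : IsPDPFractions P α d V)
    (hα : 0 < α) (hd : 0 < d) (hd1 : d < 1) (hW : IsPDPFractions P' α' 0 W) (hα' : 0 < α') :
    ¬ IdentDistrib (fun ω (h : ℕ) => weight V (h + 1) ω) (fun ω (h : ℕ) => weight W (h + 1) ω)
      P P' := by
  intro hid
  obtain ⟨L, hL⟩ := hV.exists_tendsto_variance hα hd hd1
  refine not_tendsto_nhds_of_tendsto_atTop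
    ((hW.tendsto_variance_zero hα').comp (tendsto_add_atTop_nat 1)) L ?_
  refine (hL.comp (tendsto_add_atTop_nat 1)).congr fun n => ?_
  exact (hid.comp (u := fun x : ℕ → ℝ => Real.log (x n)) (by fun_prop)).variance_eq

variable [IsProbabilityMeasure P]

lemma IsPDPFractions.tendstoInMeasure_log_div_log (hV : IsPDPFractions P α d V) (hα : 0 < α)
    (hd : 0 < d) (hd1 : d < 1) :
    TendstoInMeasure P (fun (h : ℕ) ω => Real.log (weight V h ω) / Real.log ((h : ℝ) ^ (-(1 / d))))
      atTop (fun _ => 1) := by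
  have hc : ∀ᶠ h : ℕ in atTop, Real.log ((h : ℝ) ^ (-(1 / d))) = -(1 / d) * Real.log h := by
    filter_upwards [eventually_ge_atTop 1] with h hh
    rw [Real.log_rpow (by exact_mod_cast hh)]
  obtain ⟨L, hL⟩ := hV.exists_tendsto_variance hα hd hd1
  refine tendstoInMeasure_div_of_variance (hV.eventually_memLp hα hd.le hd1) ?_ ?_
  · have := (hV.tendsto_mean_div_log hα hd hd1).div_const (-(1 / d))
    rw [div_self (by simp [hd.ne'])] at this
    refine this.congr' ?_
    filter_upwards [hc] with h hh
    rw [hh, div_div, mul_comm]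
  · have h2 : Tendsto (fun h : ℕ => (-(1 / d) * Real.log h) ^ 2) atTop atTop := by
      have := ((tendsto_pow_atTop two_ne_zero).comp tendsto_log_natCast).const_mul_atTop
        (r := (1 / d) ^ 2) (by positivity)
      refine this.congr fun h => ?_
      simp only [Function.comp_apply]
      ring
    refine (hL.div_atTop h2).congr' ?_
    filter_upwards [hc] with h hh
    rw [hh]

lemma tendsto_sqrt_natCast : Tendsto (fun h : ℕ => √(h : ℝ)) atTop atTop :=
  Real.tendsto_sqrt_atTop.comp tendsto_natCast_atTop_atTop

/-- For positive discount, `log π_h = o(√h)` in probability. -/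
lemma IsPDPFractions.tendstoInMeasure_log_div_sqrt (hV : IsPDPFractions P α d V) (hα : 0 < α)
    (hd : 0 < d) (hd1 : d < 1) :
    TendstoInMeasure P (fun (h : ℕ) ω => Real.log (weight V h ω) / √(h : ℝ))
      atTop (fun _ => 0) := by
  obtain ⟨L, hL⟩ := hV.exists_tendsto_variance hα hd hd1
  refine tendstoInMeasure_div_of_variance (hV.eventually_memLp hα hd.le hd1) ?_ ?_
  · have := (hV.tendsto_mean_div_log hα hd hd1).mul tendsto_log_div_sqrt
    rw [mul_zero] at this
    refine this.congr' ?_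
    filter_upwards [tendsto_log_natCast.eventually_gt_atTop 0] with h hh
    field_simp
  · simp_rw [Real.sq_sqrt (Nat.cast_nonneg _)]
    exact hL.div_atTop tendsto_natCast_atTop_atTop

/-- For positive discount, `log π_h = o(h)` in probability. -/
lemma IsPDPFractions.tendstoInMeasure_log_div_linear (hV : IsPDPFractions P α d V) (hα : 0 < α)
    (hd : 0 < d) (hd1 : d < 1) {r : ℝ} (hr : r ≠ 0) :
    TendstoInMeasure P (fun (h : ℕ) ω => Real.log (weight V h ω) / (h * r))
      atTop (fun _ => 0) := by
  obtain ⟨L, hL⟩ := hV.exists_tendsto_variance hα hd hd1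
  have hlin : Tendsto (fun h : ℕ => Real.log h / (h : ℝ)) atTop (𝓝 0) := by
    have := tendsto_log_div_sqrt.mul tendsto_sqrt_natCast.inv_tendsto_atTop
    rw [zero_mul] at this
    refine this.congr fun h => ?_
    rw [Pi.inv_apply, ← div_eq_mul_inv, div_div, Real.mul_self_sqrt h.cast_nonneg]
  refine tendstoInMeasure_div_of_variance (hV.eventually_memLp hα hd.le hd1) ?_ ?_
  · have := ((hV.tendsto_mean_div_log hα hd hd1).mul hlin).div_const r
    rw [mul_zero, zero_div] at this
    refine this.congr' ?_
    filter_upwards [tendsto_log_natCast.eventually_gt_atTop 0] with h hh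
    field_simp
  · have h2 : Tendsto (fun h : ℕ => ((h : ℝ) * r) ^ 2) atTop atTop := by
      have := ((tendsto_pow_atTop two_ne_zero).comp
        (tendsto_natCast_atTop_atTop (R := ℝ))).const_mul_atTop (r := r ^ 2) (by positivity)
      refine this.congr fun h => ?_
      simp only [Function.comp_apply]
      ring
    exact hL.div_atTop h2

lemma IsPDPFractions.tendstoInMeasure_log_div_log_exp (hV : IsPDPFractions P α 0 V)
    (hα : 0 < α) :
    TendstoInMeasure P
      (fun (h : ℕ) ω => Real.log (weight V h ω) / Real.log (Real.exp (-(h / α))))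
      atTop (fun _ => 1) := by
  simp_rw [Real.log_exp]
  have hN := tendsto_natCast_atTop_atTop (R := ℝ)
  refine tendstoInMeasure_div_of_variance (hV.eventually_memLp hα le_rfl one_pos) ?_ ?_
  · have := ((tendsto_const_nhds (x := -(digamma 1 - digamma α) * α)).div_atTop hN).add_const 1
    rw [zero_add] at this
    refine this.congr' ?_
    filter_upwards [eventually_ge_atTop 1] with h hh
    have : (0 : ℝ) < h := by exact_mod_cast hh
    rw [(hV.moments_log_weight_zero hα hh).2.1]
    field_simp
    ring
  · have h1 := (tendsto_const_nhds (x := (trigamma 1 - trigamma α) * α ^ 2)).div_atTop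
      ((tendsto_pow_atTop two_ne_zero).comp hN)
    have := h1.add ((tendsto_const_nhds (x := (1 : ℝ))).div_atTop hN)
    rw [zero_add] at this
    refine this.congr' ?_
    filter_upwards [eventually_ge_atTop 1] with h hh
    have : (0 : ℝ) < h := by exact_mod_cast hh
    rw [(hV.moments_log_weight_zero hα hh).2.2]
    simp only [Function.comp_apply]
    field_simp

lemma IsPDPFractions.tendstoInDistribution_sum_log_one_sub (hV : IsPDPFractions P α 0 V)
    (hα : 0 < α) :
    TendstoInDistribution
      (fun (n : ℕ) ω => (√(n : ℝ))⁻¹ *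
        (∑ k ∈ Finset.range n, Real.log (1 - V (k + 1) ω) - n * (-(1 / α))))
      atTop (id : ℝ → ℝ) (fun _ => P) (gaussianReal 0 (1 / α ^ 2).toNNReal) := by
  -- Index 0 refers to the fraction V 1. At d = 0 the digamma and trigamma terms cancel, leaving
  -- mean -1/α and variance 1/α².
  obtain ⟨h1, h2, h3⟩ := hV.moments_log_one_sub hα le_rfl one_pos 0
  have hf : Measurable fun x : ℝ => Real.log (1 - x) := by fun_prop
  simp only [mul_zero, add_zero, sub_self, zero_add, zero_sub] at h1 h2 h3
  rw [← h2]
  refine tendstoInDistribution_inv_sqrt_mul_sum_sub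
    (X := fun k ω => Real.log (1 - V (k + 1) ω)) ?_ (by simpa using h1)
    (hV.indep.comp (fun _ x => Real.log (1 - x)) fun _ => hf) fun i => ?_
  · simp only [zero_add, h3]
    exact HasLaw.id
  · have hi := hV.hasLaw (i + 1) (by omega)
    have h0 := hV.hasLaw (0 + 1) (by omega)
    rw [mul_zero] at hi h0
    exact IdentDistrib.comp ⟨hi.aemeasurable, h0.aemeasurable, hi.map_eq.trans h0.map_eq.symm⟩ hf

/-- This is the Slutsky error: `log π_h` has `log V_h` where the h-term sum of the central limit
theorem has `log (1 - V_h)`. For h ≥ 1 the law of the difference does not depend on h, so dividing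
by √h sends it to 0. -/
lemma IsPDPFractions.tendstoInMeasure_log_sub_div_sqrt (hV : IsPDPFractions P α 0 V)
    (hα : 0 < α) :
    TendstoInMeasure P (fun (h : ℕ) ω => (Real.log (V h ω) - Real.log (1 - V h ω)) / √(h : ℝ))
      atTop (fun _ => 0) := by
  have hf : MemLp (fun x => Real.log x - Real.log (1 - x)) 2 (betaMeasure 1 α) :=
    (moments_log_beta one_pos hα).1.sub (moments_log_one_sub_beta one_pos hα).1
  have hm : ∀ h : ℕ, 1 ≤ h → _ := fun h hh =>
    moments_comp_of_hasLaw (by simpa using hV.hasLaw h hh) hf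
  refine tendstoInMeasure_div_of_variance ?_ ?_ ?_
  · filter_upwards [eventually_ge_atTop 1] with h hh using (hm h hh).1
  · refine ((tendsto_const_nhds (x := ∫ x, (Real.log x - Real.log (1 - x))
      ∂(betaMeasure 1 α))).div_atTop tendsto_sqrt_natCast).congr' ?_
    filter_upwards [eventually_ge_atTop 1] with h hh
    rw [(hm h hh).2.1]
  · simp_rw [Real.sq_sqrt (Nat.cast_nonneg _)]
    refine ((tendsto_const_nhds (x := variance (fun x => Real.log x - Real.log (1 - x))
      (betaMeasure 1 α))).div_atTop (tendsto_natCast_atTop_atTop (R := ℝ))).congr' ?_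
    filter_upwards [eventually_ge_atTop 1] with h hh
    rw [(hm h hh).2.2]

lemma IsPDPFractions.tendstoInDistribution_log_weight (hV : IsPDPFractions P α 0 V)
    (hα : 0 < α) :
    TendstoInDistribution
      (fun (h : ℕ) ω => √(h : ℝ) * (1 / h * Real.log (weight V h ω) + 1 / α))
      atTop (id : ℝ → ℝ) (fun _ => P) (gaussianReal 0 (1 / α ^ 2).toNNReal) := by
  refine tendstoInDistribution_of_tendstoInMeasure_sub _ _
    (hV.tendstoInDistribution_sum_log_one_sub hα) ?_ fun h => hV.aemeasurable_sqrt_mul h _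
  refine (hV.tendstoInMeasure_log_sub_div_sqrt hα).congr' ?_ (EventuallyEq.refl _ _)
  filter_upwards [eventually_ge_atTop 1] with h hh
  obtain ⟨n, rfl⟩ := Nat.exists_eq_add_of_le' hh
  filter_upwards [hV.ae_log_weight] with ω hω
  have hs : 0 < √((n + 1 : ℕ) : ℝ) := by positivity
  -- With s = √(n + 1) and n + 1 replaced by s², the claim becomes a rational identity in s.
  have hn : ((n + 1 : ℕ) : ℝ) = √((n + 1 : ℕ) : ℝ) ^ 2 := (Real.sq_sqrt (Nat.cast_nonneg _)).symm
  simp only [Pi.sub_apply]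
  rw [hω n, Finset.sum_range_succ]
  generalize √((n + 1 : ℕ) : ℝ) = s at hs hn
  rw [hn]
  field_simp
  ring

/-- Slutsky's theorem: the expression differs from the one for the Dirichlet weights alone by -(log
π_h)/√h, which tends to 0 in probability. -/
lemma IsPDPFractions.tendstoInDistribution_log_div (hV : IsPDPFractions P α d V)
    (hW : IsPDPFractions P α 0 W) (hα : 0 < α) (hd : 0 < d) (hd1 : d < 1) :
    TendstoInDistribution
      (fun (h : ℕ) ω => √(h : ℝ) * (1 / h * Real.log (weight W h ω / weight V h ω) + 1 / α))
      atTop (id : ℝ → ℝ) (fun _ => P) (gaussianReal 0 (1 / α ^ 2).toNNReal) := by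
  refine tendstoInDistribution_of_tendstoInMeasure_sub _ _
    (hW.tendstoInDistribution_log_weight hα) ?_ fun h => ?_
  · have h0 : TendstoInMeasure P (fun (_ : ℕ) (_ : Ω) => (0 : ℝ)) atTop (fun _ => 0) :=
      tendstoInMeasure_of_tendsto_ae (fun _ => aestronglyMeasurable_const)
        (Eventually.of_forall fun _ => tendsto_const_nhds)
    have := tendstoInMeasure_sub h0 (hV.tendstoInMeasure_log_div_sqrt hα hd hd1)
    simp only [sub_zero] at this
    refine this.congr' ?_ (EventuallyEq.refl _ _)
    filter_upwards [eventually_ge_atTop 1] with h hh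
    filter_upwards [hV.ae_log_div hW hh] with ω hω
    have hs : 0 < √(h : ℝ) := Real.sqrt_pos.2 (by exact_mod_cast hh)
    have hn : (h : ℝ) = √(h : ℝ) ^ 2 := (Real.sq_sqrt (Nat.cast_nonneg _)).symm
    simp only [Pi.sub_apply]
    rw [hω]
    generalize √(h : ℝ) = s at hs hn
    rw [hn]
    field_simp
    ring
  · rcases Nat.eq_zero_or_pos h with rfl | hh
    · simp
    · have h1 := hV.aemeasurable_weight hh
      have h2 := hW.aemeasurable_weight hh
      fun_prop

lemma IsPDPFractions.tendstoInMeasure_log_div_ratio (hV : IsPDPFractions P α d V)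
    (hW : IsPDPFractions P α 0 W) (hα : 0 < α) (hd : 0 < d) (hd1 : d < 1) :
    TendstoInMeasure P
      (fun (h : ℕ) ω => Real.log (weight W h ω / weight V h ω) / Real.log (Real.exp (-(h / α))))
      atTop (fun _ => 1) := by
  have := tendstoInMeasure_sub (hW.tendstoInMeasure_log_div_log_exp hα)
    (hV.tendstoInMeasure_log_div_linear hα hd hd1 (r := -(1 / α)) (by simp [hα.ne']))
  rw [sub_zero] at this
  refine this.congr' ?_ (EventuallyEq.refl _ _)
  filter_upwards [eventually_ge_atTop 1] with h hh
  filter_upwards [hV.ae_log_div hW hh] with ω hω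
  rw [hω, Real.log_exp, sub_div, show (h : ℝ) * -(1 / α) = -(h / α) by ring]

end Limits

end StickBreaking

theorem theorem1 {Ω : Type*} [MeasurableSpace Ω] (P : Measure Ω) [IsProbabilityMeasure P]
    {Ω' : Type*} [MeasurableSpace Ω'] (P' : Measure Ω') [IsProbabilityMeasure P']
    (α₁ : ℝ) (hα₁ : 0 < α₁) :
    -- the non-Dirichlet case `0 < d < 1`
    (∀ d : ℝ, 0 < d → d < 1 → ∀ V : ℕ → Ω → ℝ, StickBreaking.IsPDPFractions P α₁ d V →
      -- the weights are not those of a Dirichlet process, whatever its mass parameter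
      (∀ α' : ℝ, 0 < α' → ∀ W : ℕ → Ω' → ℝ, StickBreaking.IsPDPFractions P' α' 0 W →
        ¬ IdentDistrib (fun ω (h : ℕ) => StickBreaking.weight V (h + 1) ω)
            (fun ω (h : ℕ) => StickBreaking.weight W (h + 1) ω) P P') ∧
      -- mean and variance
      (∀ h : ℕ, 1 ≤ h →
        MemLp (fun ω => Real.log (StickBreaking.weight V h ω)) 2 P ∧
        ∫ ω, Real.log (StickBreaking.weight V h ω) ∂P =
          StickBreaking.digamma (1 - d) - StickBreaking.digamma α₁ +
            1 / d * (StickBreaking.digamma (α₁ / d) - StickBreaking.digamma (α₁ / d + h)) ∧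
        variance (fun ω => Real.log (StickBreaking.weight V h ω)) P =
          StickBreaking.trigamma (1 - d) - StickBreaking.trigamma α₁ +
            1 / d ^ 2 *
              (StickBreaking.trigamma (α₁ / d) - StickBreaking.trigamma (α₁ / d + h))) ∧
      Tendsto (fun h : ℕ => ∫ ω, Real.log (StickBreaking.weight V h ω) ∂P) atTop atBot ∧
      (∃ L : ℝ, Tendsto (fun h : ℕ => variance (fun ω => Real.log (StickBreaking.weight V h ω)) P)
        atTop (𝓝 L)) ∧
      -- power law decay
      TendstoInMeasure P
        (fun (h : ℕ) ω => Real.log (StickBreaking.weight V h ω) / Real.log ((h : ℝ) ^ (-(1 / d))))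
        atTop (fun _ => 1)) ∧
    -- the Dirichlet case `d = 0`
    (∀ V : ℕ → Ω → ℝ, StickBreaking.IsPDPFractions P α₁ 0 V →
      (∀ h : ℕ, 1 ≤ h →
        MemLp (fun ω => Real.log (StickBreaking.weight V h ω)) 2 P ∧
        ∫ ω, Real.log (StickBreaking.weight V h ω) ∂P =
          StickBreaking.digamma 1 - StickBreaking.digamma α₁ - h / α₁ ∧
        variance (fun ω => Real.log (StickBreaking.weight V h ω)) P =
          StickBreaking.trigamma 1 - StickBreaking.trigamma α₁ + h / α₁ ^ 2) ∧
      Tendsto (fun h : ℕ => ∫ ω, Real.log (StickBreaking.weight V h ω) ∂P) atTop atBot ∧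
      Tendsto (fun h : ℕ => variance (fun ω => Real.log (StickBreaking.weight V h ω)) P)
        atTop atTop ∧
      TendstoInDistribution
        (fun (h : ℕ) ω => √(h : ℝ) * (1 / h * Real.log (StickBreaking.weight V h ω) + 1 / α₁))
        atTop (id : ℝ → ℝ) (fun _ => P) (gaussianReal 0 (1 / α₁ ^ 2).toNNReal) ∧
      -- `π*_h` is equivalent to `exp (-h / α₁)` on the logarithmic scale
      TendstoInMeasure P
        (fun (h : ℕ) ω => Real.log (StickBreaking.weight V h ω) / Real.log (Real.exp (-(h / α₁))))
        atTop (fun _ => 1)) ∧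
    -- comparison of the two cases, for every joint distribution of the two sequences
    (∀ d : ℝ, 0 < d → d < 1 → ∀ V W : ℕ → Ω → ℝ,
      StickBreaking.IsPDPFractions P α₁ d V → StickBreaking.IsPDPFractions P α₁ 0 W →
      TendstoInDistribution
        (fun (h : ℕ) ω => √(h : ℝ) *
          (1 / h * Real.log (StickBreaking.weight W h ω / StickBreaking.weight V h ω) + 1 / α₁))
        atTop (id : ℝ → ℝ) (fun _ => P) (gaussianReal 0 (1 / α₁ ^ 2).toNNReal) ∧
      TendstoInMeasure P
        (fun (h : ℕ) ω => Real.log (StickBreaking.weight W h ω / StickBreaking.weight V h ω) /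
          Real.log (Real.exp (-(h / α₁))))
        atTop (fun _ => 1)) := by
  refine ⟨fun d hd hd1 V hV => ⟨fun α' hα' W hW => hV.not_identDistrib hα₁ hd hd1 hW hα',
      fun h hh => ?_, hV.tendsto_mean_atBot hα₁ hd hd1, hV.exists_tendsto_variance hα₁ hd hd1,
      hV.tendstoInMeasure_log_div_log hα₁ hd hd1⟩,
    fun V hV => ⟨fun h hh => hV.moments_log_weight_zero hα₁ hh, hV.tendsto_mean_zero hα₁,
      hV.tendsto_variance_zero hα₁, hV.tendstoInDistribution_log_weight hα₁,
      hV.tendstoInMeasure_log_div_log_exp hα₁⟩,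
    fun d hd hd1 V W hV hW => ⟨hV.tendstoInDistribution_log_div hW hα₁ hd hd1,
      hV.tendstoInMeasure_log_div_ratio hW hα₁ hd hd1⟩⟩
  obtain ⟨h1, h2, h3⟩ := hV.moments_log_weight hα₁ hd.le hd1 hh
  refine ⟨h1, ?_, ?_⟩
  · rw [h2, ← StickBreaking.sum_eq_digamma hα₁ hd, sub_eq_add_neg]
  · rw [h3, StickBreaking.sum_eq_trigamma hα₁ hd]
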